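/- Let $k$ be an algebraically closed field and let $\Lambda=k\langle\alpha,\beta\rangle/(\alpha^2,\ \alpha\beta+\beta\alpha,\ \beta^2)$ be the exterior algebra in two variables over $k$. For $n\ge 1$ and $c\in k$ let $J_n(c)$ be the $n\times n$ Jordan block with eigenvalue $c$ (ones on the superdiagonal). For a point $p$ of $\mathbb P^1(k)=k\cup\{\infty\}$, where $c\in k$ stands for $(1:c)$ and $\infty$ for $(0:1)$, let $R_p(n)$ be the $\Lambda$-module $k^{2n}$ on which $\alpha$ and $\beta$ act by the block matrices $$\begin{pmatrix}0&0\\A&0\end{pmatrix},\qquad \begin{pmatrix}0&0\\B&0\end{pmatrix},$$ where $(A,B)=(I_n,J_n(c))$ if $p=c\in k$, and $(A,B)=(J_n(0),I_n)$ if $p=\infty$. (These are the indecomposable modules lying in the tubes of the Auslander--Reiten quiver of $\Lambda$.) Let $M$ be a finitely generated $\Lambda$-module that is a generator, i.e. every finitely generated indecomposable projective $\Lambda$-module is a direct summand of a finite direct sum of copies of $M$. Suppose that every non-projective indecomposable direct summand of $M$ is isomorphic to $R_p(n)$ for some $p\in\mathbb P^1(k)$ and some $n\ge 1$. Then $$\operatorname{gldim}\operatorname{End}_\Lambda(M)=\infty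 ,$$ that is, both the left and the right global dimension of the ring $\operatorname{End}_\Lambda(M)$ are infinite. -/

import Mathlib

universe u v w

namespace ExteriorTubes

open CategoryTheory

/-! ### Global dimension, indecomposable modules, generators -/

/-- The (left) global dimension of a ring: the supremum of the projective dimensions of all
left modules. -/
noncomputable def gldim (R : Type u) [Ring R] : WithBot ℕ∞ :=
  ⨆ X : ModuleCat.{u} R, projectiveDimension X

/-- A module is indecomposable if it is nonzero and in every internal direct sum decomposition
one of the two summands is zero. -/
def IsIndecomposable (R : Type u) [Ring R] (X : Type v) [AddCommGroup X] [Module R X] : Prop :=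
  Nontrivial X ∧ ∀ N N' : Submodule R X, IsCompl N N' → N = ⊥ ∨ N' = ⊥

/-- `X` belongs to `add M`: it is a direct summand (a retract) of a finite direct sum of copies
of `M`. -/
def InAdd (R : Type u) [Ring R] (M : Type v) [AddCommGroup M] [Module R M]
    (X : Type w) [AddCommGroup X] [Module R X] : Prop :=
  ∃ (m : ℕ) (i : X →ₗ[R] (Fin m → M)) (r : (Fin m → M) →ₗ[R] X), r ∘ₗ i = LinearMap.id

/-- `M` is a generator for `mod R`: every finitely generated indecomposable projective
`R`-module is in `add M`. -/
def IsGenerator (R : Type u) [Ring R] (M : Type v) [AddCommGroup M] [Module R M] : Prop :=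
  ∀ (P : Type u) [AddCommGroup P] [Module R P], Module.Finite R P → Module.Projective R P →
    IsIndecomposable R P → InAdd R M P

/-! ### The exterior algebra in two variables and its modules in tubes -/

/-- The exterior algebra in two variables over `k`. -/
abbrev Ext2 (k : Type u) [Field k] : Type u := ExteriorAlgebra k (Fin 2 → k)

/-- The generator `α` of the exterior algebra. -/
noncomputable def Ext2.α (k : Type u) [Field k] : Ext2 k := ExteriorAlgebra.ι k (Pi.single 0 1)

/-- The generator `β` of the exterior algebra. -/
noncomputable def Ext2.β (k : Type u) [Field k] : Ext2 k := ExteriorAlgebra.ι k (Pi.single 1 1)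

/-- The vector space `k^{2n}`, as underlying space of the representation of the exterior algebra
in which `α` and `β` act by the block matrices `(0 0; A 0)` and `(0 0; B 0)`. -/
def BlockRep {k : Type u} [Field k] {n : ℕ} (_A _B : Matrix (Fin n) (Fin n) k) : Type u :=
  Fin n ⊕ Fin n → k

namespace BlockRep

variable {k : Type u} [Field k] {n : ℕ} (A B : Matrix (Fin n) (Fin n) k)

instance : AddCommGroup (BlockRep A B) := inferInstanceAs (AddCommGroup (Fin n ⊕ Fin n → k))

instance : Module k (BlockRep A B) := inferInstanceAs (Module k (Fin n ⊕ Fin n → k))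

/-- The action of `a α + b β`: the matrix `(0 0; a A + b B 0)`. -/
noncomputable def act : (Fin 2 → k) →ₗ[k] Module.End k (Fin n ⊕ Fin n → k) where
  toFun v := Matrix.toLin' (Matrix.fromBlocks 0 0 (v 0 • A + v 1 • B) 0)
  map_add' v w := by
    rw [← map_add, Matrix.fromBlocks_add]
    congr 2 <;> simp [add_smul, add_add_add_comm]
  map_smul' c v := by
    rw [RingHom.id_apply, ← map_smul, Matrix.fromBlocks_smul]
    congr 2 <;> simp [mul_smul]

theorem act_sq (v : Fin 2 → k) : act A B v * act A B v = 0 := by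
  change Matrix.toLin' _ ∘ₗ Matrix.toLin' _ = 0
  rw [← Matrix.toLin'_mul, Matrix.fromBlocks_multiply]
  simp

/-- The algebra homomorphism from the exterior algebra to the endomorphisms of `k^{2n}`. -/
noncomputable def rep : Ext2 k →ₐ[k] Module.End k (Fin n ⊕ Fin n → k) :=
  ExteriorAlgebra.lift k ⟨act A B, act_sq A B⟩

noncomputable instance : Module (Ext2 k) (BlockRep A B) :=
  Module.compHom (Fin n ⊕ Fin n → k) (rep A B).toRingHom

theorem α_smul (x : BlockRep A B) :
    Ext2.α k • x = (Matrix.fromBlocks 0 0 A 0).mulVec (x : Fin n ⊕ Fin n → k) := by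
  change rep A B (Ext2.α k) x = _
  simp [rep, Ext2.α, act]
  rfl

theorem β_smul (x : BlockRep A B) :
    Ext2.β k • x = (Matrix.fromBlocks 0 0 B 0).mulVec (x : Fin n ⊕ Fin n → k) := by
  change rep A B (Ext2.β k) x = _
  simp [rep, Ext2.β, act]
  rfl

theorem algebraMap_smul' (c : k) (x : BlockRep A B) :
    algebraMap k (Ext2 k) c • x = c • x := by
  change rep A B (algebraMap k (Ext2 k) c) x = _
  rw [AlgHom.commutes]
  rfl

end BlockRep

/-- The `n × n` Jordan block with eigenvalue `c` (ones on the superdiagonal). -/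
def jordanBlock {k : Type u} [Field k] (n : ℕ) (c : k) : Matrix (Fin n) (Fin n) k :=
  Matrix.of fun i j => if i = j then c else if (i : ℕ) + 1 = (j : ℕ) then 1 else 0

/-- The lower left block of the matrix of `α` on `R_p(n)`. The projective line is `k ∪ {∞}`:
the point `(1 : c)` is `c` and the point `(0 : 1)` is `∞`. -/
def tubeα {k : Type u} [Field k] (p : OnePoint k) (n : ℕ) : Matrix (Fin n) (Fin n) k :=
  match p with
  | some _ => 1
  | none => jordanBlock n 0

/-- The lower left block of the matrix of `β` on `R_p(n)`. -/
def tubeβ {k : Type u} [Field k] (p : OnePoint k) (n : ℕ) : Matrix (Fin n) (Fin n) k :=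
  match p with
  | some c => jordanBlock n c
  | none => 1

/-- The module `R_p(n)` of dimension `2n` in the tube of rank one at the point `p` of the
projective line. -/
abbrev TubeModule {k : Type u} [Field k] (p : OnePoint k) (n : ℕ) : Type u :=
  BlockRep (tubeα p n) (tubeβ p n)

end ExteriorTubes

/-!
Write `Λ` for the exterior algebra, `Γ` for `End M`, and consider the elements `ℓ = t α + β` of `Λ`,
which have square zero. A `Λ`-module has no homology with respect to `ℓ` if the kernel of `ℓ` on it
equals the image. This holds for `Λ`, hence for projective modules, and it holds for `R_p(n)` as
soon as `p ≠ -t` (`isAcyclicAt_tubeModule`). Since `M` has finite length and `k` is infinite, some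
`t` avoids all the points `p` that occur in `M`, and then `M` has no homology with respect to `ℓ`
(`finite_setOf_not_isAcyclicAt`). The simple `Λ`-module does have homology, so it should have no
finite resolution by summands of `M`; the same idea is carried out over `Γ`, on both sides.

As `Λ` is local and `M` is a generator, `Λ` is a direct summand of `M`. Let `e` be the corresponding
idempotent of `Γ`, and let `λ` in `eΓe`, the opposite ring of `Λ`, correspond to `ℓ`. For a left
`Γ`-module `Y`, consider the homology of `λ` on `eY`. For `Y = Γ` it is the homology of `ℓ` on
`Hom(M, Λ)`; this vanishes because it does on `M` and `Λ` is a Frobenius algebra, which makes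
`Hom(M, Λ)` the `k`-dual of `M` (`exists_eq_mul_lin`). For right modules and `Y = Γ` it is the
homology of `ℓ` on `Hom(Λ, M) = M`. Hence it vanishes for free and projective modules, and by
dimension shifting for all modules of finite projective dimension
(`isAcyclicAt_of_hasProjectiveDimensionLT`). It does not vanish for `Γ / Γλ`: the class of `e` is
killed by `λ`, and `e` does not lie in `λΓ + Γλ`, because the augmentation of `Λ` kills `ℓ`. So this
module has infinite projective dimension (`gldim_eq_top_of_isAcyclicAt`).
-/

namespace ExteriorTubes

open CategoryTheory

/-! ### A homological obstruction to finite global dimension -/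

/-- The subspace `eY` of an `R`-module `Y` has no homology with respect to `l`: every element of
`eY` killed by `l` is a multiple of `l`. -/
def IsAcyclicAt {R : Type u} [Ring R] (e l : R) (Y : Type v) [AddCommGroup Y] [Module R Y] : Prop :=
  ∀ y : Y, e • y = y → l • y = 0 → ∃ z : Y, y = l • z

namespace IsAcyclicAt

variable {R : Type u} [Ring R] {e l : R} {X : Type v} {Y : Type w}
  [AddCommGroup X] [Module R X] [AddCommGroup Y] [Module R Y]

theorem of_retract (h : IsAcyclicAt e l Y) (i : X →ₗ[R] Y) (r : Y →ₗ[R] X)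
    (hri : ∀ x, r (i x) = x) : IsAcyclicAt e l X := by
  intro x hx hlx
  obtain ⟨z, hz⟩ := h (i x) (by rw [← map_smul, hx]) (by rw [← map_smul, hlx, map_zero])
  exact ⟨r z, by rw [← map_smul, ← hz, hri]⟩

theorem of_isCompl {N N' : Submodule R X} (hN : IsCompl N N') (h : IsAcyclicAt e l N)
    (h' : IsAcyclicAt e l N') : IsAcyclicAt e l X := by
  have prod : IsAcyclicAt e l (N × N') := by
    rintro ⟨a, b⟩ hab hlab
    rw [Prod.smul_mk, Prod.mk.injEq] at hab
    rw [Prod.smul_mk, Prod.mk_eq_zero] at hlab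
    obtain ⟨z, hz⟩ := h a hab.1 hlab.1
    obtain ⟨z', hz'⟩ := h' b hab.2 hlab.2
    exact ⟨(z, z'), by rw [Prod.smul_mk, ← hz, ← hz']⟩
  let E := Submodule.prodEquivOfIsCompl N N' hN
  exact prod.of_retract E.symm.toLinearMap E.toLinearMap (fun x => E.apply_symm_apply x)

theorem finsupp {ι : Type*} (h : IsAcyclicAt e l R) :
    IsAcyclicAt e l (ι →₀ R) := by
  intro y hy hly
  have hy' (i : ι) : ∃ z : R, y i = l • z :=
    h (y i) (by rw [← Finsupp.smul_apply, hy]) (by rw [← Finsupp.smul_apply, hly]; rfl)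
  choose z hz using hy'
  classical
  refine ⟨Finsupp.onFinset y.support (fun i => if i ∈ y.support then z i else 0)
    (fun i hi => by by_contra hn; simp [hn] at hi), ?_⟩
  ext i
  by_cases hi : i ∈ y.support
  · rw [Finsupp.smul_apply, Finsupp.onFinset_apply, if_pos hi, hz i]
  · rw [Finsupp.smul_apply, Finsupp.onFinset_apply, if_neg hi, smul_zero,
      Finsupp.notMem_support_iff.mp hi]

theorem of_projective (h : IsAcyclicAt e l R) [Module.Projective R X] :
    IsAcyclicAt e l X := by
  obtain ⟨s, hs⟩ := Module.projective_def'.mp ‹Module.Projective R X›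
  exact h.finsupp.of_retract s (Finsupp.linearCombination R id) (LinearMap.congr_fun hs)

/-- Acyclicity passes to cokernels of injections between acyclic modules: this is the part of the
long exact homology sequence needed for dimension shifting. -/
theorem of_surjective (he : e * e = e) (hel : e * l = l) (hle : l * e = l) (hl : l * l = 0)
    (f : X →ₗ[R] Y) (hf : Function.Surjective f) (hX : IsAcyclicAt e l X)
    (hK : IsAcyclicAt e l (LinearMap.ker f)) : IsAcyclicAt e l Y := by
  intro y hy hly
  obtain ⟨x, rfl⟩ := hf y
  obtain ⟨z, hz⟩ := hK ⟨l • x, by rw [LinearMap.mem_ker, map_smul, hly]⟩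
    (Subtype.ext (by simp [smul_smul, hel])) (Subtype.ext (by simp [smul_smul, hl]))
  have hz' : l • x = l • (z : X) := congrArg Subtype.val hz
  have hfz : f z = 0 := z.2
  obtain ⟨q, hq⟩ := hX (e • (x - z)) (by rw [smul_smul, he])
    (by rw [smul_smul, hle, smul_sub, hz', sub_self])
  exact ⟨f q, by rw [← map_smul, ← hq, map_smul, map_sub, hfz, sub_zero, hy]⟩

end IsAcyclicAt

theorem isAcyclicAt_of_hasProjectiveDimensionLT {R : Type u} [Ring R] {e l : R} (he : e * e = e)
    (hel : e * l = l) (hle : l * e = l) (hl : l * l = 0) (h : IsAcyclicAt e l R) (n : ℕ)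
    (X : Type u) [AddCommGroup X] [Module R X]
    (hX : HasProjectiveDimensionLT (ModuleCat.of R X) (n + 1)) : IsAcyclicAt e l X := by
  induction n generalizing X with
  | zero =>
    have := (IsProjective.iff_projective (R := R) X).mpr
      (projective_iff_hasProjectiveDimensionLT_one.mpr hX)
    exact h.of_projective
  | succ n ih =>
    let f : (X →₀ R) →ₗ[R] X := Finsupp.linearCombination R id
    have hf : Function.Surjective f := Finsupp.linearCombination_id_surjective R X
    have hS := LinearMap.shortExact_shortComplexKer hf
    have hP : Projective (ModuleCat.of R (X →₀ R)) :=
      (IsProjective.iff_projective (R := R) (X →₀ R)).mp inferInstance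
    refine .of_surjective he hel hle hl f hf h.finsupp (ih _ ?_)
    exact (hS.hasProjectiveDimensionLT_X₃_iff n hP).mp hX

/-- If a ring `R` is acyclic with respect to `l` but the pair `(e, l)` satisfies
`e ∉ lR + Rl`, then `R / Rl` is not acyclic, hence has infinite projective dimension. -/
theorem gldim_eq_top_of_isAcyclicAt {R : Type u} [Ring R] {e l : R} (he : e * e = e)
    (hel : e * l = l) (hle : l * e = l) (hl : l * l = 0) (h : IsAcyclicAt e l R)
    (hne : ∀ z w : R, e ≠ l * z + w * l) : gldim R = ⊤ := by
  let L : Submodule R R := Submodule.span R {l}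
  -- The class of `e` is killed by `l` because `l * e = l`, but it is not a multiple of `l`.
  have hY : projectiveDimension (ModuleCat.of R (R ⧸ L)) = ⊤ := by
    by_contra hfin
    obtain ⟨n, hn⟩ := (projectiveDimension_ne_top_iff _).mp hfin
    obtain ⟨z, hz⟩ := isAcyclicAt_of_hasProjectiveDimensionLT he hel hle hl h n (R ⧸ L) hn
      (L.mkQ e) (by rw [← map_smul, smul_eq_mul, he])
      (by
        rw [← map_smul, smul_eq_mul, hle]
        exact (Submodule.Quotient.mk_eq_zero L).mpr (Submodule.mem_span_singleton_self l))
    obtain ⟨z, rfl⟩ := L.mkQ_surjective z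
    rw [← map_smul, ← sub_eq_zero, ← map_sub, Submodule.mkQ_apply, Submodule.Quotient.mk_eq_zero,
      Submodule.mem_span_singleton] at hz
    obtain ⟨w, hw⟩ := hz
    refine hne z w ?_
    rw [smul_eq_mul, smul_eq_mul] at hw
    rw [hw, add_sub_cancel]
  rw [gldim, eq_top_iff, ← hY]
  exact le_iSup (fun X : ModuleCat.{u} R => projectiveDimension X) (ModuleCat.of R (R ⧸ L))

/-! ### Coordinates on the exterior algebra -/

namespace Ext2

variable {k : Type u} [Field k]

/-- Left multiplication by `v 0 • α + v 1 • β` in the coordinates given by `1, α, β, αβ`. -/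
noncomputable def mulLeftCoord : (Fin 2 → k) →ₗ[k] Module.End k (Fin 4 → k) where
  toFun v := Matrix.toLin' !![0, 0, 0, 0; v 0, 0, 0, 0; v 1, 0, 0, 0; 0, -v 1, v 0, 0]
  map_add' v w := by
    rw [← map_add]
    congr 1
    ext i j
    fin_cases i <;> fin_cases j <;> simp [add_comm]
  map_smul' c v := by
    rw [RingHom.id_apply, ← map_smul]
    congr 1
    ext i j
    fin_cases i <;> fin_cases j <;> simp

theorem mulLeftCoord_apply (v : Fin 2 → k) (x : Fin 4 → k) :
    mulLeftCoord v x = ![0, v 0 * x 0, v 1 * x 0, v 0 * x 2 - v 1 * x 1] := by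
  ext i
  fin_cases i <;> simp [mulLeftCoord, Matrix.mulVec, dotProduct, Fin.sum_univ_four]
  ring

/-- The left regular representation of the exterior algebra, in the coordinates given by
`1, α, β, αβ`. -/
noncomputable def regularRep : Ext2 k →ₐ[k] Module.End k (Fin 4 → k) :=
  ExteriorAlgebra.lift k ⟨mulLeftCoord, fun v => by
    refine LinearMap.ext fun x => ?_
    rw [Module.End.mul_apply, mulLeftCoord_apply, mulLeftCoord_apply]
    ext i
    fin_cases i <;> simp
    ring⟩

/-- The coordinates of an element of the exterior algebra in the basis `1, α, β, αβ`. -/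
noncomputable def coord : Ext2 k →ₗ[k] (Fin 4 → k) :=
  LinearMap.applyₗ ![1, 0, 0, 0] ∘ₗ regularRep.toLinearMap

theorem coord_mul_eq (x y : Ext2 k) : coord (x * y) = regularRep x (coord y) := by
  simp [coord]

@[simp]
theorem coord_one : coord (1 : Ext2 k) = ![1, 0, 0, 0] := by
  simp [coord]

theorem coord_ι_mul (v : Fin 2 → k) (y : Ext2 k) :
    coord (ExteriorAlgebra.ι k v * y) = mulLeftCoord v (coord y) := by
  rw [coord_mul_eq, regularRep, ExteriorAlgebra.lift_ι_apply]

theorem coord_α_mul (y : Ext2 k) : coord (α k * y) = ![0, coord y 0, 0, coord y 2] := by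
  rw [α, coord_ι_mul, mulLeftCoord_apply]
  simp

theorem coord_β_mul (y : Ext2 k) : coord (β k * y) = ![0, 0, coord y 0, -coord y 1] := by
  rw [β, coord_ι_mul, mulLeftCoord_apply]
  simp

theorem ι_eq (v : Fin 2 → k) : ExteriorAlgebra.ι k v = v 0 • α k + v 1 • β k := by
  rw [α, β, ← map_smul, ← map_smul, ← map_add]
  congr 1
  ext i
  fin_cases i <;> simp

theorem α_mul_α : α k * α k = 0 := ExteriorAlgebra.ι_sq_zero _

theorem β_mul_β : β k * β k = 0 := ExteriorAlgebra.ι_sq_zero _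

theorem β_mul_α : β k * α k = -(α k * β k) :=
  eq_neg_of_add_eq_zero_left (ExteriorAlgebra.ι_add_mul_swap _ _)

theorem eq_sum_coord (x : Ext2 k) :
    x = coord x 0 • 1 + coord x 1 • α k + coord x 2 • β k + coord x 3 • (α k * β k) := by
  induction x using CliffordAlgebra.left_induction with
  | algebraMap r =>
    rw [Algebra.algebraMap_eq_smul_one, map_smul]
    simp
  | add x y hx hy =>
    simp only [map_add, Pi.add_apply, add_smul]
    nth_rw 1 [hx, hy]
    abel
  | ι_mul x v hx =>
    change ExteriorAlgebra.ι k v * x = _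
    change _ = coord (ExteriorAlgebra.ι k v * x) 0 • _ + coord (ExteriorAlgebra.ι k v * x) 1 • _ +
      coord (ExteriorAlgebra.ι k v * x) 2 • _ + coord (ExteriorAlgebra.ι k v * x) 3 • _
    rw [coord_ι_mul, mulLeftCoord_apply, ι_eq]
    nth_rw 1 [hx]
    have h1 : β k * (α k * β k) = 0 := by
      rw [← mul_assoc, β_mul_α, neg_mul, mul_assoc, β_mul_β, mul_zero, neg_zero]
    have h2 : α k * (α k * β k) = 0 := by rw [← mul_assoc, α_mul_α, zero_mul]
    simp only [mul_add, add_mul, smul_mul_assoc, mul_smul_comm, mul_one, α_mul_α, β_mul_β, β_mul_α,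
      h1, h2, Matrix.cons_val]
    module

theorem coord_injective : Function.Injective (coord : Ext2 k → Fin 4 → k) := by
  intro x y h
  rw [eq_sum_coord x, eq_sum_coord y, h]

theorem coord_mul (x y : Ext2 k) : coord (x * y) =
    ![coord x 0 * coord y 0, coord x 0 * coord y 1 + coord x 1 * coord y 0,
      coord x 0 * coord y 2 + coord x 2 * coord y 0,
      coord x 0 * coord y 3 + coord x 3 * coord y 0 + coord x 1 * coord y 2
        - coord x 2 * coord y 1] := by
  nth_rw 1 [eq_sum_coord x]
  simp only [add_mul, smul_mul_assoc, map_add, map_smul, one_mul, mul_assoc, coord_α_mul,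
    coord_β_mul]
  ext i
  fin_cases i <;> simp [Matrix.vecHead, Matrix.vecTail]
  ring

/-- The element of the exterior algebra with given coordinates. -/
noncomputable def ofCoord (c : Fin 4 → k) : Ext2 k :=
  c 0 • 1 + c 1 • α k + c 2 • β k + c 3 • (α k * β k)

@[simp]
theorem coord_α : coord (α k) = ![0, 1, 0, 0] := by
  simpa using coord_α_mul (1 : Ext2 k)

@[simp]
theorem coord_β : coord (β k) = ![0, 0, 1, 0] := by
  simpa using coord_β_mul (1 : Ext2 k)

@[simp]
theorem coord_ofCoord (c : Fin 4 → k) : coord (ofCoord c) = c := by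
  simp only [ofCoord, map_add, map_smul, coord_one, coord_α, coord_α_mul, coord_β]
  ext i
  fin_cases i <;> simp

instance : Module.Finite k (Ext2 k) :=
  Module.Finite.of_injective coord coord_injective

instance : IsArtinianRing (Ext2 k) := IsArtinianRing.of_finite k (Ext2 k)

/-- Every nonzero left ideal contains the socle element `αβ`. -/
theorem α_mul_β_mem {N : Submodule (Ext2 k) (Ext2 k)} (hN : N ≠ ⊥) : α k * β k ∈ N := by
  obtain ⟨x, hx, hx0⟩ := N.exists_mem_ne_zero_of_ne_bot hN
  suffices ∃ y : Ext2 k, y * x = α k * β k by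
    obtain ⟨y, hy⟩ := this
    exact hy ▸ N.smul_mem y hx
  have key (y : Ext2 k) (h : coord (y * x) = ![0, 0, 0, 1]) : ∃ y : Ext2 k, y * x = α k * β k :=
    ⟨y, coord_injective (by rw [h, coord_α_mul]; simp)⟩
  by_cases h0 : coord x 0 = 0
  · by_cases h1 : coord x 1 = 0
    · by_cases h2 : coord x 2 = 0
      · have h3 : coord x 3 ≠ 0 := fun h3 => hx0 (coord_injective (by
          rw [map_zero]; ext i; fin_cases i <;> simp [h0, h1, h2, h3]))
        exact key (ofCoord ![(coord x 3)⁻¹, 0, 0, 0]) (by simp [coord_mul, h0, h1, h2, h3])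
      · exact key (ofCoord ![0, (coord x 2)⁻¹, 0, 0]) (by simp [coord_mul, h0, h2])
    · exact key (ofCoord ![0, 0, -(coord x 1)⁻¹, 0]) (by simp [coord_mul, h0, h1])
  · exact key (ofCoord ![0, 0, 0, (coord x 0)⁻¹]) (by simp [coord_mul, h0])

theorem isIndecomposable : IsIndecomposable (Ext2 k) (Ext2 k) := by
  refine ⟨inferInstance, fun N N' h => ?_⟩
  by_contra! hne
  have h0 := (Submodule.disjoint_def.mp h.disjoint) _ (α_mul_β_mem hne.1) (α_mul_β_mem hne.2)
  have := congrFun (congrArg coord h0) 3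
  simp [coord_α_mul] at this

/-- The exterior algebra is local: an element of nonzero augmentation has a left inverse. -/
theorem exists_mul_eq_one {x : Ext2 k} (hx : coord x 0 ≠ 0) : ∃ y : Ext2 k, y * x = 1 := by
  refine ⟨ofCoord ![(coord x 0)⁻¹, -coord x 1 * (coord x 0)⁻¹ ^ 2, -coord x 2 * (coord x 0)⁻¹ ^ 2,
    -coord x 3 * (coord x 0)⁻¹ ^ 2], coord_injective ?_⟩
  rw [coord_mul, coord_ofCoord, coord_one]
  ext i
  fin_cases i <;> simp <;> field_simp <;> ring

/-! ### Homology with respect to an element of degree one -/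

/-- The element `t α + β`. -/
noncomputable def lin (t : k) : Ext2 k := t • α k + β k

@[simp]
theorem coord_lin (t : k) : coord (lin t) = ![0, t, 1, 0] := by
  simp only [lin, map_add, map_smul, coord_α, coord_β]
  ext i
  fin_cases i <;> simp

theorem lin_mul_lin (t : k) : lin t * lin t = 0 := by
  apply coord_injective
  rw [coord_mul, coord_lin, map_zero]
  ext i
  fin_cases i <;> simp

theorem smul_eq_sum {M : Type v} [AddCommGroup M] [Module k M] [Module (Ext2 k) M]
    [IsScalarTower k (Ext2 k) M] (x : Ext2 k) (m : M) :
    x • m = coord x 0 • m + coord x 1 • α k • m + coord x 2 • β k • m +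
      coord x 3 • (α k * β k) • m := by
  nth_rw 1 [eq_sum_coord x]
  simp only [add_smul, smul_assoc, one_smul]

/-- The exterior algebra is a Frobenius algebra: every `k`-linear form on a module `M` is the top
coordinate of a unique homomorphism to the exterior algebra. This is the homomorphism. -/
noncomputable def homOfDual {M : Type v} [AddCommGroup M] [Module k M] [Module (Ext2 k) M]
    [IsScalarTower k (Ext2 k) M] (f : M →ₗ[k] k) : M →ₗ[Ext2 k] Ext2 k where
  toFun m := ofCoord ![f ((α k * β k) • m), -f (β k • m), f (α k • m), f m]
  map_add' m m' := by
    apply coord_injective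
    rw [map_add]
    simp only [coord_ofCoord, smul_add, map_add]
    ext i
    fin_cases i <;> simp [add_comm]
  map_smul' x m := by
    apply coord_injective
    have hα : α k • x • m = coord x 0 • α k • m + coord x 2 • (α k * β k) • m := by
      rw [smul_smul, smul_eq_sum, coord_α_mul]
      simp
    have hβ : β k • x • m = coord x 0 • β k • m - coord x 1 • (α k * β k) • m := by
      rw [smul_smul, smul_eq_sum, coord_β_mul]
      simp [sub_eq_add_neg]
    have hαβ : (α k * β k) • x • m = coord x 0 • (α k * β k) • m := by
      rw [smul_smul, smul_eq_sum, mul_assoc, coord_α_mul, coord_β_mul]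
      simp
    rw [RingHom.id_apply, smul_eq_mul, coord_mul]
    simp only [coord_ofCoord, hαβ, hα, hβ]
    rw [smul_eq_sum x m]
    simp only [map_add, map_sub, map_smul, smul_eq_mul]
    ext i
    fin_cases i <;> simp <;> ring

@[simp]
theorem coord_homOfDual {M : Type v} [AddCommGroup M] [Module k M] [Module (Ext2 k) M]
    [IsScalarTower k (Ext2 k) M] (f : M →ₗ[k] k) (m : M) : coord (homOfDual f m) 3 = f m := by
  change coord (ofCoord _) 3 = _
  simp

/-- A homomorphism to the exterior algebra is determined by its top coordinate. -/
theorem hom_eq_zero_of_coord {M : Type v} [AddCommGroup M] [Module (Ext2 k) M]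
    (φ : M →ₗ[Ext2 k] Ext2 k) (h : ∀ m, coord (φ m) 3 = 0) (m : M) : φ m = 0 := by
  have h' (x : Ext2 k) : coord (x * φ m) 3 = 0 := by rw [← smul_eq_mul, ← map_smul, h]
  have h0 := h' (α k * β k)
  have h1 := h' (β k)
  have h2 := h' (α k)
  have h3 := h m
  simp only [mul_assoc, coord_α_mul, coord_β_mul, Matrix.cons_val, neg_eq_zero] at h0 h1 h2
  apply coord_injective
  rw [map_zero]
  ext i
  fin_cases i <;> simp [h0, h1, h2, h3]

theorem isAcyclicAt_lin (t : k) : IsAcyclicAt 1 (lin t) (Ext2 k) := by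
  intro y _ hy
  have h : coord (lin t * y) = 0 := by rw [← smul_eq_mul, hy, map_zero]
  rw [coord_mul, coord_lin] at h
  have h0 : coord y 0 = 0 := by simpa using congrFun h 2
  have h1 : coord y 1 = t * coord y 2 := by
    have := congrFun h 3
    simp only [Matrix.cons_val, Pi.zero_apply] at this
    linear_combination -this
  refine ⟨ofCoord ![coord y 2, -coord y 3, 0, 0], coord_injective ?_⟩
  rw [smul_eq_mul, coord_mul, coord_lin, coord_ofCoord]
  ext i
  fin_cases i <;> simp [h0, h1]

end Ext2

open Ext2

variable {k : Type u} [Field k]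

/-! ### Modules in tubes -/

theorem lin_smul_blockRep {n : ℕ} (A B : Matrix (Fin n) (Fin n) k) (t : k) (x : BlockRep A B) :
    lin t • x = (Matrix.fromBlocks 0 0 (t • A + B) 0).mulVec (x : Fin n ⊕ Fin n → k) := by
  have h : lin t • x = t • α k • x + β k • x := by
    rw [lin, add_smul, Algebra.smul_def, mul_smul, BlockRep.algebraMap_smul']
  rw [h, BlockRep.α_smul, BlockRep.β_smul]
  have key (y : Fin n ⊕ Fin n → k) :
      t • (Matrix.fromBlocks (0 : Matrix (Fin n) (Fin n) k) 0 A 0).mulVec y +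
        (Matrix.fromBlocks 0 0 B 0).mulVec y = (Matrix.fromBlocks 0 0 (t • A + B) 0).mulVec y := by
    rw [← Matrix.smul_mulVec, ← Matrix.add_mulVec, Matrix.fromBlocks_smul, Matrix.fromBlocks_add]
    simp
  exact key x

theorem exists_eq_fromBlocks_mulVec {n : ℕ} {C : Matrix (Fin n) (Fin n) k} (h : IsUnit C.det)
    (y : Fin n ⊕ Fin n → k)
    (hy : (Matrix.fromBlocks (0 : Matrix (Fin n) (Fin n) k) (0 : Matrix (Fin n) (Fin n) k)
      C 0).mulVec y = 0) :
    ∃ z, y = (Matrix.fromBlocks (0 : Matrix (Fin n) (Fin n) k) (0 : Matrix (Fin n) (Fin n) k)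
      C 0).mulVec z := by
  obtain ⟨a, b, rfl⟩ : ∃ a b, y = Sum.elim a b := ⟨_, _, (Sum.elim_comp_inl_inr y).symm⟩
  rw [Matrix.fromBlocks_mulVec] at hy
  have ha : C.mulVec a = 0 := by
    ext i
    simpa using congrFun hy (Sum.inr i)
  have ha0 : a = 0 := by
    rw [← Matrix.one_mulVec a, ← Matrix.nonsing_inv_mul C h, ← Matrix.mulVec_mulVec, ha,
      Matrix.mulVec_zero]
  refine ⟨Sum.elim (C⁻¹.mulVec b) 0, ?_⟩
  rw [Matrix.fromBlocks_mulVec]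
  simp [Matrix.mulVec_mulVec, Matrix.mul_nonsing_inv C h, ha0]

theorem isAcyclicAt_blockRep {n : ℕ} (A B : Matrix (Fin n) (Fin n) k) (t : k)
    (h : IsUnit (t • A + B).det) : IsAcyclicAt 1 (lin t) (BlockRep A B) := by
  intro y _ hy
  obtain ⟨z, hz⟩ := exists_eq_fromBlocks_mulVec h y ((lin_smul_blockRep A B t y).symm.trans hy)
  exact ⟨z, hz.trans (lin_smul_blockRep A B t z).symm⟩

/-- The element `t α + β` acts on `R_p(n)` without homology unless `p` is the point `-t`. -/
theorem isAcyclicAt_tubeModule (p : OnePoint k) (n : ℕ) (t : k) (h : p ≠ ((-t : k) : OnePoint k)) :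
    IsAcyclicAt 1 (lin t) (TubeModule p n) := by
  refine isAcyclicAt_blockRep _ _ t (Ne.isUnit ?_)
  induction p using OnePoint.rec with
  | infty =>
    rw [Matrix.det_of_isUpperTriangular]
    · refine Finset.prod_ne_zero_iff.mpr fun i _ => ?_
      change t * jordanBlock n 0 i i + (1 : Matrix (Fin n) (Fin n) k) i i ≠ 0
      simp [jordanBlock]
    · intro i j hij
      have hij' : j < i := hij
      change t * jordanBlock n 0 i j + (1 : Matrix (Fin n) (Fin n) k) i j = 0
      have h1 : (i : ℕ) + 1 ≠ j := by have := Fin.lt_def.mp hij'; omega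
      simp [jordanBlock, hij'.ne', h1]
  | coe c =>
    rw [Matrix.det_of_isUpperTriangular]
    · refine Finset.prod_ne_zero_iff.mpr fun i _ => ?_
      change t * (1 : Matrix (Fin n) (Fin n) k) i i + jordanBlock n c i i ≠ 0
      intro h0
      refine h (congrArg _ ?_)
      simp [jordanBlock] at h0
      linear_combination h0
    · intro i j hij
      have hij' : j < i := hij
      change t * (1 : Matrix (Fin n) (Fin n) k) i j + jordanBlock n c i j = 0
      have h1 : (i : ℕ) + 1 ≠ j := by have := Fin.lt_def.mp hij'; omega
      simp [jordanBlock, hij'.ne', h1]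

/-! ### Decomposition into indecomposable summands -/

/-- If each indecomposable summand of `M` has homology with respect to `t α + β` for finitely many
`t` only, then so does every summand of `M`: a decomposable one splits into two smaller ones. -/
theorem finite_setOf_not_isAcyclicAt {M : Type v} [AddCommGroup M] [Module (Ext2 k) M]
    [IsArtinian (Ext2 k) M]
    (h : ∀ N N' : Submodule (Ext2 k) M, IsCompl N N' → IsIndecomposable (Ext2 k) N →
      {t : k | ¬ IsAcyclicAt 1 (lin t) N}.Finite)
    (N N' : Submodule (Ext2 k) M) (hN : IsCompl N N') :
    {t : k | ¬ IsAcyclicAt 1 (lin t) N}.Finite := by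
  induction N using WellFoundedLT.induction generalizing N' with
  | ind N ih =>
    by_cases hind : IsIndecomposable (Ext2 k) N
    · exact h N N' hN hind
    by_cases hnt : Nontrivial N
    swap
    · rw [not_nontrivial_iff_subsingleton] at hnt
      refine Set.finite_empty.subset fun t ht => ht ?_
      exact fun y _ _ => ⟨0, Subsingleton.elim _ _⟩
    obtain ⟨K, K', hK, hK0, hK0'⟩ :
        ∃ K K' : Submodule (Ext2 k) N, IsCompl K K' ∧ K ≠ ⊥ ∧ K' ≠ ⊥ := by
      by_contra! hcon
      exact hind ⟨hnt, fun K K' hK => or_iff_not_imp_left.mpr fun hK0 => hcon K K' hK hK0⟩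
    have main (K K' : Submodule (Ext2 k) N) (hK : IsCompl K K') (hK0' : K' ≠ ⊥) :
        {t : k | ¬ IsAcyclicAt 1 (lin t) K}.Finite := by
      have hsup : K.map N.subtype ⊔ K'.map N.subtype = N := by
        rw [← Submodule.map_sup, hK.sup_eq_top, Submodule.map_subtype_top]
      have hdisj : Disjoint (K.map N.subtype) (K'.map N.subtype) :=
        Submodule.disjoint_map N.injective_subtype hK.disjoint
      have hlt : K.map N.subtype < N := by
        refine lt_of_le_of_ne (N.map_subtype_le K) fun heq => hK0' ?_
        have htop : K = ⊤ := Submodule.map_injective_of_injective N.injective_subtype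
          (by rw [heq, Submodule.map_subtype_top])
        simpa [htop] using hK.disjoint
      have hcompl : IsCompl (K.map N.subtype) (K'.map N.subtype ⊔ N') := by
        refine ⟨?_, ?_⟩
        · refine hdisj.disjoint_sup_right_of_disjoint_sup_left ?_
          rw [hsup]
          exact hN.disjoint
        · rw [codisjoint_iff, ← sup_assoc, hsup, hN.sup_eq_top]
      refine (ih _ hlt _ hcompl).subset fun t ht hac => ht ?_
      let E := Submodule.equivMapOfInjective N.subtype N.injective_subtype K
      exact hac.of_retract E.toLinearMap E.symm.toLinearMap E.symm_apply_apply
    refine ((main K K' hK hK0').union (main K' K hK.symm hK0)).subset fun t ht => ?_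
    by_contra hcon
    rw [Set.mem_union, Set.mem_ofPred_eq, Set.mem_ofPred_eq, not_or, not_not, not_not] at hcon
    exact ht (.of_isCompl hK hcon.1 hcon.2)

/-! ### The endomorphism ring of a generator -/

section Endomorphisms

variable {M : Type v} [AddCommGroup M] [Module (Ext2 k) M]

/-- A generator has a free direct summand of rank one. -/
theorem IsGenerator.exists_apply_eq_one (h : IsGenerator (Ext2 k) M) :
    ∃ (x : M) (r : M →ₗ[Ext2 k] Ext2 k), r x = 1 := by
  obtain ⟨m, i, r, hri⟩ := h (Ext2 k) inferInstance inferInstance isIndecomposable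
  have hsum : ∑ j, r (Pi.single j (i 1 j)) = 1 := by
    rw [← map_sum, Finset.univ_sum_single]
    exact LinearMap.congr_fun hri 1
  -- The algebra is local, so one of the summands is a unit.
  obtain ⟨j, hj⟩ : ∃ j, coord (r (Pi.single j (i 1 j))) 0 ≠ 0 := by
    by_contra! hcon
    have := congrFun (congrArg coord hsum) 0
    rw [map_sum, Finset.sum_apply, Finset.sum_eq_zero fun j _ => hcon j] at this
    simp at this
  obtain ⟨y, hy⟩ := exists_mul_eq_one hj
  refine ⟨y • i 1 j, r ∘ₗ LinearMap.single (Ext2 k) (fun _ => M) j, ?_⟩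
  rw [map_smul, smul_eq_mul]
  exact hy

/-- The functor `Hom(-, Λ)` is a duality, so it carries the vanishing of the homology of
`t α + β` on `M` to the right module `Hom(M, Λ)`. -/
theorem exists_eq_mul_lin {t : k} (hM : IsAcyclicAt 1 (lin t) M) (ψ : M →ₗ[Ext2 k] Ext2 k)
    (hψ : ∀ m, ψ m * lin t = 0) : ∃ χ : M →ₗ[Ext2 k] Ext2 k, ∀ m, χ m * lin t = ψ m := by
  let _ : Module k M := Module.compHom M (algebraMap k (Ext2 k))
  have : IsScalarTower k (Ext2 k) M := .of_algebraMap_smul fun _ _ => rfl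
  -- Only the degree one part of `x` contributes, and it anticommutes with `t α + β`.
  have hswap (x : Ext2 k) : coord (x * lin t) 3 = -coord (lin t * x) 3 := by
    rw [coord_mul, coord_mul, coord_lin]
    simp
    ring
  let L : M →ₗ[k] M := (DistribSMul.toLinearMap k M (lin t))
  let f : M →ₗ[k] k := LinearMap.proj 3 ∘ₗ coord ∘ₗ ψ.restrictScalars k
  have hf : f ∈ (LinearMap.ker L).dualAnnihilator := by
    rw [Submodule.mem_dualAnnihilator]
    intro m hm
    obtain ⟨z, rfl⟩ := hM m (one_smul _ m) hm
    change coord (ψ (lin t • z)) 3 = 0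
    rw [map_smul, smul_eq_mul, ← neg_eq_zero, ← hswap, hψ, map_zero, Pi.zero_apply]
  rw [← LinearMap.range_dualMap_eq_dualAnnihilator_ker] at hf
  obtain ⟨g, hg⟩ := hf
  have hg' (m : M) : g (lin t • m) = coord (ψ m) 3 := LinearMap.congr_fun hg m
  refine ⟨homOfDual (-g), fun m => ?_⟩
  let φ : M →ₗ[Ext2 k] Ext2 k := (LinearMap.toSpanSingleton _ _ (lin t)) ∘ₗ homOfDual (-g) - ψ
  refine sub_eq_zero.mp (hom_eq_zero_of_coord φ (fun m => ?_) m)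
  change coord (homOfDual (-g) m * lin t - ψ m) 3 = 0
  rw [map_sub, Pi.sub_apply, hswap, ← smul_eq_mul, ← map_smul, coord_homOfDual, LinearMap.neg_apply,
    hg', neg_neg, sub_self]

/-- The endomorphism `m ↦ r(m) a x` of `M`; for `r x = 1` these are the endomorphisms of the free
summand spanned by `x`, extended by zero. For `a = 1` this is the idempotent `e`, for
`a = t α + β` the element `λ`. -/
def cornerEnd (r : M →ₗ[Ext2 k] Ext2 k) (x : M) (a : Ext2 k) : Module.End (Ext2 k) M :=
  LinearMap.toSpanSingleton (Ext2 k) M (a • x) ∘ₗ r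

theorem cornerEnd_apply (r : M →ₗ[Ext2 k] Ext2 k) (x : M) (a : Ext2 k) (m : M) :
    cornerEnd r x a m = r m • a • x := rfl

variable {r : M →ₗ[Ext2 k] Ext2 k} {x : M}

theorem cornerEnd_mul (hx : r x = 1) (a b : Ext2 k) :
    cornerEnd r x a * cornerEnd r x b = cornerEnd r x (b * a) := by
  ext m
  simp only [Module.End.mul_apply, cornerEnd_apply, map_smul, hx, smul_smul, mul_assoc, one_mul]

theorem cornerEnd_zero : cornerEnd r x 0 = 0 := by
  ext m
  simp [cornerEnd_apply]

/-- The left module `eΓ` over `eΓe` is `Hom(M, Λ)`, on which `λ` acts as right multiplication by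
`t α + β`. -/
theorem isAcyclicAt_end (hx : r x = 1) {t : k} (hM : IsAcyclicAt 1 (lin t) M) :
    IsAcyclicAt (cornerEnd r x 1) (cornerEnd r x (lin t)) (Module.End (Ext2 k) M) := by
  intro f hf hlf
  obtain ⟨χ, hχ⟩ := exists_eq_mul_lin hM (r ∘ₗ f) fun m => by
    have := congrArg r (LinearMap.congr_fun hlf m)
    simpa [cornerEnd_apply, hx] using this
  refine ⟨LinearMap.toSpanSingleton (Ext2 k) M x ∘ₗ χ, ?_⟩
  ext m
  have h1 : f m = r (f m) • x := by
    have := LinearMap.congr_fun hf m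
    simpa [cornerEnd_apply] using this.symm
  rw [h1]
  simp only [smul_eq_mul, Module.End.mul_apply, cornerEnd_apply, LinearMap.comp_apply,
    LinearMap.toSpanSingleton_apply, map_smul, hx, smul_smul, one_mul, hχ]

/-- The right module `Γe` over `eΓe` is `Hom(Λ, M) = M`, on which `λ` acts as `t α + β`. -/
theorem isAcyclicAt_end_op (hx : r x = 1) {t : k} (hM : IsAcyclicAt 1 (lin t) M) :
    IsAcyclicAt (MulOpposite.op (cornerEnd r x 1)) (MulOpposite.op (cornerEnd r x (lin t)))
      (Module.End (Ext2 k) M)ᵐᵒᵖ := by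
  intro f hf hlf
  induction f using MulOpposite.rec' with
  | h f =>
    rw [smul_eq_mul, ← MulOpposite.op_mul] at hf hlf
    replace hf := MulOpposite.op_injective hf
    replace hlf : f * cornerEnd r x (lin t) = 0 := MulOpposite.op_injective hlf
    obtain ⟨y, hy⟩ := hM (f x) (one_smul _ _) (by
      have := LinearMap.congr_fun hlf x
      simpa [cornerEnd_apply, hx] using this)
    refine ⟨MulOpposite.op (LinearMap.toSpanSingleton (Ext2 k) M y ∘ₗ r), ?_⟩
    rw [smul_eq_mul, ← MulOpposite.op_mul]
    congr 1
    ext m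
    have h1 : f m = r m • f x := by
      have := LinearMap.congr_fun hf m
      simpa [cornerEnd_apply] using this.symm
    rw [h1, hy]
    simp only [Module.End.mul_apply, cornerEnd_apply, LinearMap.comp_apply,
      LinearMap.toSpanSingleton_apply, map_smul, hx, smul_smul, mul_one]

/-- The identity of the free summand is not in the two-sided span of `t α + β`, because the
augmentation of the exterior algebra kills the latter. -/
theorem cornerEnd_one_ne (hx : r x = 1) (t : k) (f g : Module.End (Ext2 k) M) :
    cornerEnd r x 1 ≠ cornerEnd r x (lin t) * f + g * cornerEnd r x (lin t) := by
  intro h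
  have h1 := congrFun (congrArg coord (congrArg r (LinearMap.congr_fun h x))) 0
  simp [cornerEnd_apply, hx, coord_mul] at h1

theorem gldim_end_eq_top (hx : r x = 1) {t : k} (hM : IsAcyclicAt 1 (lin t) M) :
    gldim (Module.End (Ext2 k) M) = ⊤ ∧ gldim (Module.End (Ext2 k) M)ᵐᵒᵖ = ⊤ := by
  have he : cornerEnd r x 1 * cornerEnd r x 1 = cornerEnd r x 1 := by
    rw [cornerEnd_mul hx, one_mul]
  have hel : cornerEnd r x 1 * cornerEnd r x (lin t) = cornerEnd r x (lin t) := by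
    rw [cornerEnd_mul hx, mul_one]
  have hle : cornerEnd r x (lin t) * cornerEnd r x 1 = cornerEnd r x (lin t) := by
    rw [cornerEnd_mul hx, one_mul]
  have hl : cornerEnd r x (lin t) * cornerEnd r x (lin t) = 0 := by
    rw [cornerEnd_mul hx, lin_mul_lin, cornerEnd_zero]
  refine ⟨gldim_eq_top_of_isAcyclicAt he hel hle hl (isAcyclicAt_end hx hM) (cornerEnd_one_ne hx t),
    gldim_eq_top_of_isAcyclicAt (congrArg MulOpposite.op he) (congrArg MulOpposite.op hle)
      (congrArg MulOpposite.op hel) (congrArg MulOpposite.op hl) (isAcyclicAt_end_op hx hM)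
      fun z w h => ?_⟩
  refine cornerEnd_one_ne hx t w.unop z.unop ?_
  rw [add_comm]
  exact congrArg MulOpposite.unop h

end Endomorphisms

end ExteriorTubes

theorem mainTheorem4 {k : Type u} [Field k] [IsAlgClosed k]
    (M : Type v) [AddCommGroup M] [Module (ExteriorTubes.Ext2 k) M]
    [Module.Finite (ExteriorTubes.Ext2 k) M]
    (hgen : ExteriorTubes.IsGenerator (ExteriorTubes.Ext2 k) M)
    (htube : ∀ N N' : Submodule (ExteriorTubes.Ext2 k) M, IsCompl N N' →
      ExteriorTubes.IsIndecomposable (ExteriorTubes.Ext2 k) N →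
      ¬ Module.Projective (ExteriorTubes.Ext2 k) N →
      ∃ (p : OnePoint k) (n : ℕ), 1 ≤ n ∧
        Nonempty (N ≃ₗ[ExteriorTubes.Ext2 k] ExteriorTubes.TubeModule p n)) :
    ExteriorTubes.gldim (Module.End (ExteriorTubes.Ext2 k) M) = ⊤ ∧
      ExteriorTubes.gldim (Module.End (ExteriorTubes.Ext2 k) M)ᵐᵒᵖ = ⊤ := by
  open ExteriorTubes in
  have hfin := finite_setOf_not_isAcyclicAt (k := k) (M := M) (fun N N' hN hind => by
    by_cases hproj : Module.Projective (Ext2 k) N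
    · exact Set.finite_empty.subset fun t ht => ht (Ext2.isAcyclicAt_lin t).of_projective
    · obtain ⟨p, n, -, ⟨E⟩⟩ := htube N N' hN hind hproj
      have hinj : Function.Injective fun t : k => ((-t : k) : OnePoint k) :=
        OnePoint.coe_injective.comp neg_injective
      refine ((Set.finite_singleton p).preimage hinj.injOn).subset fun t ht => ?_
      by_contra hp
      exact ht ((isAcyclicAt_tubeModule p n t fun h => hp h.symm).of_retract E.toLinearMap
        E.symm.toLinearMap E.symm_apply_apply)) ⊤ ⊥ isCompl_top_bot
  -- An algebraically closed field is infinite, so some `t` avoids all the points in `M`.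
  obtain ⟨t, ht⟩ := hfin.exists_notMem
  have hM : ExteriorTubes.IsAcyclicAt 1 (ExteriorTubes.Ext2.lin t) M := by
    have h := not_not.mp ht
    let E := Submodule.topEquiv (R := ExteriorTubes.Ext2 k) (M := M)
    exact h.of_retract E.symm.toLinearMap E.toLinearMap E.apply_symm_apply
  obtain ⟨x, r, hx⟩ := hgen.exists_apply_eq_one
  exact ExteriorTubes.gldim_end_eq_top hx hM
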